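/- A convex body in the $n$-dimensional Euclidean space $\mathbb{E}^n$ is a compact convex set with non-empty interior. For $A,B\subset\mathbb{E}^n$ let $C(A,B)$ be the smallest number of translates of $B$ required to cover $A$ (with $C(A,B)=\infty$ if no finite number of translates suffices), and let $$H_n=\sup\{\,C(K,\operatorname{int}(K)) : K\subset\mathbb{E}^n \text{ a convex body}\,\},$$ that is, $H_n$ is the smallest number $N$ such that every convex body $K\subset\mathbb{E}^n$ can be covered by at most $N$ translates of its interior. Theorem. $H_4\le 96$, $H_5\le 1091$ and $H_6\le 15373$. -/

import Mathlib

open scoped Pointwise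

/-- `translativeCoveringNumber A B` is the smallest number of translates of `B` required to cover
`A`: the least cardinality of a set `T` of translation vectors such that the translates `t +ᵥ B`, `t ∈ T`, cover `A`.
It is `⊤` if no finite number of translates of `B` covers `A`. -/
noncomputable def translativeCoveringNumber {n : ℕ} (A B : Set (EuclideanSpace ℝ (Fin n))) : ℕ∞ :=
  ⨅ (T : Set (EuclideanSpace ℝ (Fin n))) (_ : A ⊆ ⋃ t ∈ T, (t +ᵥ B)), T.encard

/-- The Hadwiger covering number `H_n`: the least number `N` such that every convex body `K`
(a compact convex set with non-empty interior) in `n`-dimensional Euclidean space can be covered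
by at most `N` translates of its interior, i.e. the supremum over all `K` of the covering number
of `K` by translates of `interior K`. Mathlib's `ConvexBody` does not include the condition on the
interior, so it is added here. -/
noncomputable def hadwigerCoveringNumber (n : ℕ) : ℕ∞ :=
  ⨆ (K : ConvexBody (EuclideanSpace ℝ (Fin n)))
    (_ : (interior (K : Set (EuclideanSpace ℝ (Fin n)))).Nonempty),
    translativeCoveringNumber (K : Set (EuclideanSpace ℝ (Fin n)))
      (interior (K : Set (EuclideanSpace ℝ (Fin n))))

/-!
A largest parallelepiped spanned by vectors of `K - K` gives an affine map that places `K` in the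
unit cube and makes it contain a unit segment in each coordinate direction. Convex combinations of
these segments show that each box with side lengths adding up to less than `1` has a translate in
the interior of `K`, so the points of such a box are illuminated by a single direction.

Rays from points of `K` carry illumination of the faces of codimension two of the cube over to
all of `K`, provided that each facet of the cube contains a point of `K` that is illuminated or
different from the point considered. One additional direction per facet ensures this, and covering
the faces of codimension two by few boxes gives the bounds in dimensions five and six.

In dimension four the additional directions are only used if some facet contains a single point
of `K`. The direction assigned to this point then illuminates a neighborhood of it as well, so the
cube can be replaced by a box that is shorter in one direction, and fewer boxes suffice.
-/

open Set Filter Topology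

section Illumination

variable {E : Type*} [TopologicalSpace E] [AddCommGroup E] [Module ℝ E]

/-- The direction `u` illuminates the point `x` of the body `K` (in the sense of Boltyanski) if a
ray from `x` in the direction `u` starts by entering the interior of `K`. For convex `K` and
`x ∈ K` it suffices that the ray meets the interior, which is what is required here. -/
def IlluminatesAt (K : Set E) (u x : E) : Prop :=
  ∃ μ : ℝ, 0 < μ ∧ x + μ • u ∈ interior K

/-- A set `U` of directions illuminates the body `K` if each point of `K` is illuminated by a
direction in `U`. -/
def Illuminates (U K : Set E) : Prop :=
  ∀ x ∈ K, ∃ u ∈ U, IlluminatesAt K u x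

theorem Illuminates.of_affine_image {F : Type*} [TopologicalSpace F] [AddCommGroup F] [Module ℝ F]
    (A : E ≃ᴬ[ℝ] F) {K : Set E} {U : Set F} (h : Illuminates U (A '' K)) :
    Illuminates (A.linear.symm '' U) K := by
  intro x hx
  obtain ⟨u, hu, μ, hμ, hxu⟩ := h _ (mem_image_of_mem A hx)
  refine ⟨A.linear.symm u, mem_image_of_mem _ hu, μ, hμ, ?_⟩
  have hA : A (x + μ • A.linear.symm u) = A x + μ • u := by
    have := A.toAffineEquiv.map_vadd x (μ • A.linear.symm u)
    simpa [add_comm] using this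
  rw [← hA] at hxu
  have himage := A.toHomeomorph.image_interior K
  obtain ⟨y, hy, hyx⟩ : A (x + μ • A.linear.symm u) ∈ A '' interior K := himage.symm ▸ hxu
  rwa [← A.injective hyx]

variable {K U : Set E} {o g u x : E}

theorem illuminatesAt_sub (ho : o ∈ interior K) (g : E) : IlluminatesAt K (o - g) g :=
  ⟨1, one_pos, by simpa using ho⟩

variable [IsTopologicalAddGroup E]

theorem isOpen_setOf_illuminatesAt (K : Set E) (u : E) : IsOpen {x | IlluminatesAt K u x} := by
  have : {x | IlluminatesAt K u x} = ⋃ μ > (0 : ℝ), (· + μ • u) ⁻¹' interior K := by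
    ext x; simp [IlluminatesAt]
  rw [this]
  exact isOpen_biUnion fun μ _ => isOpen_interior.preimage (by fun_prop)

theorem illuminatesAt_of_mem_interior [ContinuousSMul ℝ E] (hx : x ∈ interior K) (u : E) :
    IlluminatesAt K u x := by
  have hcont : ContinuousAt (fun μ : ℝ => x + μ • u) 0 := by fun_prop
  have hev : ∀ᶠ μ : ℝ in 𝓝[>] 0, x + μ • u ∈ interior K :=
    (hcont.eventually_mem (isOpen_interior.mem_nhds (by simpa using hx))).filter_mono
      nhdsWithin_le_nhds
  obtain ⟨μ, hxμ, hμ⟩ := (hev.and self_mem_nhdsWithin).exists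
  exact ⟨μ, hμ, hxμ⟩

variable [ContinuousConstSMul ℝ E]

theorem add_smul_mem_interior_of_le (hK : Convex ℝ K) (hx : x ∈ K) {μ ν : ℝ} (hν : 0 < ν)
    (hνμ : ν ≤ μ) (h : x + μ • u ∈ interior K) : x + ν • u ∈ interior K := by
  have hμ : 0 < μ := hν.trans_le hνμ
  have := hK.add_smul_mem_interior hx h (t := ν / μ) ⟨by positivity, (div_le_one hμ).2 hνμ⟩
  rwa [smul_smul, div_mul_cancel₀ _ hμ.ne'] at this

theorem IlluminatesAt.of_lineMap (hK : Convex ℝ K) (hg : g ∈ K) {r : ℝ} (hr : 1 ≤ r)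
    (h : IlluminatesAt K u (AffineMap.lineMap g x r)) : IlluminatesAt K u x := by
  obtain ⟨μ, hμ, h⟩ := h
  have hr0 : 0 < r := one_pos.trans_le hr
  have hcombo : x + (r⁻¹ * μ) • u =
      (1 - r⁻¹) • g + r⁻¹ • (AffineMap.lineMap g x r + μ • u) := by
    rw [AffineMap.lineMap_apply_module', smul_add, smul_add, smul_smul, inv_mul_cancel₀ hr0.ne']
    module
  refine ⟨r⁻¹ * μ, by positivity, hcombo ▸ ?_⟩
  exact hK.combo_self_interior_mem_interior hg h (sub_nonneg.2 (inv_le_one_of_one_le₀ hr))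
    (by positivity) (by ring)

theorem Illuminates.exists_forall_add_smul_mem_interior (hc : IsCompact K) (hK : Convex ℝ K)
    (hU : Illuminates U K) :
    ∃ ε : ℝ, 0 < ε ∧ ∀ x ∈ K, ∃ u ∈ U, x + ε • u ∈ interior K := by
  suffices ∃ ε : ℝ, 0 < ε ∧ ∀ x ∈ K ∩ K, ∃ u ∈ U, x + ε • u ∈ interior K by simpa using this
  refine hc.induction_on (p := fun s => ∃ ε : ℝ, 0 < ε ∧ ∀ x ∈ s ∩ K, ∃ u ∈ U,
    x + ε • u ∈ interior K) ⟨1, by simp⟩ ?_ ?_ ?_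
  · rintro s t hst ⟨ε, hε, h⟩
    exact ⟨ε, hε, fun x hx => h x ⟨hst hx.1, hx.2⟩⟩
  · rintro s t ⟨ε, hε, hs⟩ ⟨δ, hδ, ht⟩
    refine ⟨min ε δ, lt_min hε hδ, ?_⟩
    rintro x ⟨hx | hx, hxK⟩
    · obtain ⟨u, hu, h⟩ := hs x ⟨hx, hxK⟩
      exact ⟨u, hu, add_smul_mem_interior_of_le hK hxK (lt_min hε hδ) (min_le_left _ _) h⟩
    · obtain ⟨u, hu, h⟩ := ht x ⟨hx, hxK⟩
      exact ⟨u, hu, add_smul_mem_interior_of_le hK hxK (lt_min hε hδ) (min_le_right _ _) h⟩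
  · intro x hx
    obtain ⟨u, hu, μ, hμ, h⟩ := hU x hx
    have hopen : IsOpen ((· + μ • u) ⁻¹' interior K) := isOpen_interior.preimage (by fun_prop)
    exact ⟨_, mem_nhdsWithin_of_mem_nhds (hopen.mem_nhds h), μ, hμ, fun y hy => ⟨u, hu, hy.1⟩⟩

end Illumination

theorem translativeCoveringNumber_interior_le_encard {n : ℕ}
    {K U : Set (EuclideanSpace ℝ (Fin n))} (hc : IsCompact K) (hK : Convex ℝ K)
    (hU : Illuminates U K) : translativeCoveringNumber K (interior K) ≤ U.encard := by
  obtain ⟨ε, -, hε⟩ := hU.exists_forall_add_smul_mem_interior hc hK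
  have hcover : K ⊆ ⋃ t ∈ (fun u => -(ε • u)) '' U, (t +ᵥ interior K) := by
    intro x hx
    obtain ⟨u, hu, h⟩ := hε x hx
    exact mem_biUnion (mem_image_of_mem _ hu) (mem_vadd_set.2 ⟨_, h, by simp⟩)
  exact (iInf₂_le (f := fun (T : Set (EuclideanSpace ℝ (Fin n)))
    (_ : K ⊆ ⋃ t ∈ T, (t +ᵥ interior K)) => T.encard) _ hcover).trans (encard_image_le _ _)

section UnitCubePosition

/-- The body `K` lies in the unit cube and contains a unit segment in each coordinate direction. -/
structure InUnitCubePosition {ι : Type*} [DecidableEq ι] (K : Set (ι → ℝ)) : Prop where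
  isCompact : IsCompact K
  convex : Convex ℝ K
  interior_nonempty : (interior K).Nonempty
  subset_Icc : K ⊆ Icc 0 1
  exists_segment : ∀ i, ∃ p ∈ K, p + Pi.single i 1 ∈ K

variable {ι E : Type*} [NormedAddCommGroup E] [NormedSpace ℝ E]

theorem exists_basis_forall_mem_of_span_eq_top {R V : Type*} [Field R] [AddCommGroup V]
    [Module R V] (b : Module.Basis ι R V) {D : Set V} (hD : Submodule.span R D = ⊤) :
    ∃ v : Module.Basis ι R V, ∀ i, v i ∈ D := by
  obtain ⟨s, hsD, hs, hli⟩ := exists_linearIndependent R D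
  let v := Module.Basis.mk hli (by simp [hs, hD])
  refine ⟨v.reindex (v.indexEquiv b), fun i => ?_⟩
  simpa [v] using hsD (Subtype.coe_prop _)

/-- As in Auerbach's lemma, the basis is chosen in `D` with the largest possible determinant. -/
theorem exists_basis_forall_abs_coord_le_one [Finite ι] (b : Module.Basis ι ℝ E) {D : Set E}
    (hc : IsCompact D) (hD : Submodule.span ℝ D = ⊤) :
    ∃ v : Module.Basis ι ℝ E, (∀ i, v i ∈ D) ∧ ∀ x ∈ D, ∀ i, |v.coord i x| ≤ 1 := by
  classical
  cases nonempty_fintype ι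
  have : FiniteDimensional ℝ E := b.finiteDimensional_of_finite
  obtain ⟨w, hw⟩ := exists_basis_forall_mem_of_span_eq_top b hD
  have hcont : Continuous fun v : ι → E => |b.det v| := by
    simp only [Module.Basis.det_apply]
    refine (Continuous.matrix_det (continuous_matrix fun i j => ?_)).abs
    exact (b.coord i).continuous_of_finiteDimensional.comp (continuous_apply j)
  obtain ⟨v, hvD, hmax⟩ := (isCompact_univ_pi fun _ : ι => hc).exists_isMaxOn
    ⟨w, fun i _ => hw i⟩ hcont.continuousOn
  have hdet : 0 < |b.det v| :=
    (abs_pos.2 (b.isUnit_det w).ne_zero).trans_le (hmax fun i _ => hw i)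
  obtain ⟨hli, hsp⟩ := b.is_basis_iff_det.2 (abs_pos.1 hdet).isUnit
  refine ⟨.mk hli hsp.ge, fun i => by simpa using hvD i trivial, fun x hx i => ?_⟩
  have hcramer : b.det v * (Module.Basis.mk hli hsp.ge).coord i x =
      b.det (Function.update v i x) :=
    LinearMap.congr_fun (b.det_smul_mk_coord_eq_det_update hli hsp.ge i) x
  have hle : |b.det (Function.update v i x)| ≤ |b.det v| := hmax fun j _ => by
    rcases eq_or_ne j i with rfl | hj
    · simpa using hx
    · simpa [hj] using hvD j trivial
  rw [← hcramer, abs_mul] at hle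
  exact (mul_le_iff_le_one_right hdet).1 hle

theorem span_sub_self_eq_top {K : Set E} (hK : (interior K).Nonempty) :
    Submodule.span ℝ (K - K) = ⊤ :=
  AffineSubspace.vectorSpan_eq_top_of_affineSpan_eq_top ℝ E E
    (affineSpan_eq_top_of_nonempty_interior (hK.mono (interior_mono (subset_convexHull ℝ K))))

theorem exists_inUnitCubePosition_image [Finite ι] [DecidableEq ι] (b : Module.Basis ι ℝ E)
    {K : Set E} (hc : IsCompact K) (hK : Convex ℝ K) (hi : (interior K).Nonempty) :
    ∃ A : E ≃ᴬ[ℝ] (ι → ℝ), InUnitCubePosition (A '' K) := by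
  have : FiniteDimensional ℝ E := b.finiteDimensional_of_finite
  obtain ⟨v, hv, hcoord⟩ := exists_basis_forall_abs_coord_le_one b
    (by simpa only [sub_eq_add_neg] using hc.add hc.neg) (span_sub_self_eq_top hi)
  choose q hq p hp hqp using hv
  let A : E ≃ᴬ[ℝ] (ι → ℝ) := v.equivFunL.toContinuousAffineEquiv.trans
    (ContinuousAffineEquiv.constVAdd ℝ (ι → ℝ) fun i => -v.coord i (p i))
  have hA : ∀ x i, A x i = v.coord i x - v.coord i (p i) := fun x i => by
    simp only [sub_eq_neg_add]
    rfl
  have hvi : ∀ i j, v.coord j (v i) = (Pi.single i 1 : ι → ℝ) j := fun i j => by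
    simp [Finsupp.single_eq_pi_single]
  have hq_eq : ∀ i, q i = p i + v i := fun i => eq_add_of_sub_eq' (hqp i)
  refine ⟨A, hc.image A.continuous, hK.affine_image (A : E →ᵃ[ℝ] ι → ℝ), ?_, ?_, fun i => ?_⟩
  · exact A.toHomeomorph.image_interior K ▸ hi.image A
  · rintro _ ⟨x, hx, rfl⟩
    refine ⟨fun i => ?_, fun i => ?_⟩
    · have := (abs_le.1 (hcoord (q i - x) (sub_mem_sub (hq i) hx) i)).2
      rw [hq_eq, map_sub, map_add, hvi, Pi.single_eq_same] at this
      rw [hA, Pi.zero_apply]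
      linarith
    · have := (abs_le.1 (hcoord (x - p i) (sub_mem_sub hx (hp i)) i)).2
      rwa [hA, ← map_sub]
  · refine ⟨_, mem_image_of_mem A (hp i), q i, hq i, funext fun j => ?_⟩
    rw [Pi.add_apply, hA, hA, hq_eq, map_add, hvi]
    ring

end UnitCubePosition

theorem hadwigerCoveringNumber_le_of_forall_illuminates {n : ℕ} {N : ℕ∞}
    (h : ∀ K : Set (Fin n → ℝ), InUnitCubePosition K →
      ∃ U : Set (Fin n → ℝ), U.encard ≤ N ∧ Illuminates U K) :
    hadwigerCoveringNumber n ≤ N := by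
  refine iSup₂_le fun K hK => ?_
  obtain ⟨A, hA⟩ := exists_inUnitCubePosition_image
    (EuclideanSpace.basisFun (Fin n) ℝ).toBasis K.isCompact K.convex hK
  obtain ⟨U, hUN, hU⟩ := h _ hA
  exact ((translativeCoveringNumber_interior_le_encard K.isCompact K.convex
    (hU.of_affine_image A)).trans (encard_image_le _ _)).trans hUN

section Boxes

open AffineMap

variable {ι : Type*} {A B A' B' g y z : ι → ℝ} {f : ι × Bool}

/-- The signed distance of `z` to a facet of the box `Icc A B`, negative beyond the facet: the pair
`(i, false)` stands for the facet `z i = A i` and the pair `(i, true)` for the facet `z i = B i`. -/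
def facetDist (A B : ι → ℝ) (f : ι × Bool) (z : ι → ℝ) : ℝ :=
  if f.2 then B f.1 - z f.1 else z f.1 - A f.1

theorem mem_Icc_iff_facetDist_nonneg : z ∈ Icc A B ↔ ∀ f, 0 ≤ facetDist A B f z := by
  simp [facetDist, Pi.le_def, Prod.forall, forall_and]

theorem facetDist_congr (h : g f.1 = y f.1) : facetDist A B f g = facetDist A B f y := by
  rw [facetDist, facetDist, h]

theorem apply_eq_of_facetDist_eq (h : facetDist A B f g = facetDist A B f y) : g f.1 = y f.1 := by
  unfold facetDist at h
  split_ifs at h <;> linarith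

theorem facetDist_lineMap (A B : ι → ℝ) (f : ι × Bool) (g y : ι → ℝ) (r : ℝ) :
    facetDist A B f (lineMap g y r) = lineMap (facetDist A B f g) (facetDist A B f y) r := by
  simp only [facetDist, lineMap_apply_module, Pi.add_apply, Pi.smul_apply, smul_eq_mul]
  split_ifs <;> ring

theorem continuous_facetDist (A B : ι → ℝ) (f : ι × Bool) : Continuous (facetDist A B f) := by
  unfold facetDist
  split_ifs <;> fun_prop

theorem facetDist_pos_of_mem_interior [Finite ι] (hz : z ∈ interior (Icc A B)) (f : ι × Bool) :
    0 < facetDist A B f z := by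
  simp only [← pi_univ_Icc, interior_pi_set finite_univ, interior_Icc, mem_univ_pi, mem_Ioo] at hz
  unfold facetDist
  split_ifs <;> linarith [hz f.1]

/-- The facet `f` of the box `Icc A B`, see `facetDist` for the indexing. -/
def boxFacet (A B : ι → ℝ) (f : ι × Bool) : Set (ι → ℝ) :=
  {z ∈ Icc A B | facetDist A B f z = 0}

/-- The union of the faces of codimension two of the box `Icc A B`. -/
def codimTwoSkeleton (A B : ι → ℝ) : Set (ι → ℝ) :=
  {z | ∃ f f' : ι × Bool, f.1 ≠ f'.1 ∧ z ∈ boxFacet A B f ∩ boxFacet A B f'}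

theorem left_mem_codimTwoSkeleton [Nontrivial ι] (h : A ≤ B) : A ∈ codimTwoSkeleton A B := by
  obtain ⟨i, j, hij⟩ := exists_pair_ne ι
  exact ⟨(i, false), (j, false), hij, ⟨left_mem_Icc.2 h, by simp [facetDist]⟩,
    left_mem_Icc.2 h, by simp [facetDist]⟩

/-- The affine map that scales the coordinates so that the box `Icc A B` becomes `Icc A' B'`. -/
noncomputable def boxMap (A B A' B' z : ι → ℝ) (i : ι) : ℝ :=
  A' i + (B' i - A' i) / (B i - A i) * (z i - A i)

theorem boxMap_apply_sub_boxMap_apply (A B A' B' y z : ι → ℝ) (i : ι) :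
    boxMap A B A' B' y i - boxMap A B A' B' z i =
      (B' i - A' i) / (B i - A i) * (y i - z i) := by
  unfold boxMap
  ring

theorem monotone_boxMap (h : A ≤ B) (h' : A' ≤ B') :
    Monotone (boxMap A B A' B') := fun z y hzy i => by
  rw [← sub_nonneg, boxMap_apply_sub_boxMap_apply]
  exact mul_nonneg (div_nonneg (sub_nonneg.2 (h' i)) (sub_nonneg.2 (h i))) (sub_nonneg.2 (hzy i))

theorem boxMap_boxMap (h : ∀ i, A i < B i) (h' : ∀ i, A' i < B' i)
    (z : ι → ℝ) : boxMap A' B' A B (boxMap A B A' B' z) = z := by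
  ext i
  have := (sub_pos.2 (h i)).ne'
  have := (sub_pos.2 (h' i)).ne'
  unfold boxMap
  field_simp
  ring

theorem facetDist_boxMap (h : A f.1 < B f.1)
    (A' B' z : ι → ℝ) : facetDist A' B' f (boxMap A B A' B' z) =
      (B' f.1 - A' f.1) / (B f.1 - A f.1) * facetDist A B f z := by
  have := (sub_pos.2 h).ne'
  unfold facetDist boxMap
  split_ifs
  · field_simp
    ring
  · ring

theorem boxMap_mem_boxFacet (h : ∀ i, A i < B i) (h' : A' ≤ B')
    (hz : z ∈ boxFacet A B f) : boxMap A B A' B' z ∈ boxFacet A' B' f := by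
  refine ⟨mem_Icc_iff_facetDist_nonneg.2 fun f' => ?_, ?_⟩
  · rw [facetDist_boxMap (h _)]
    exact mul_nonneg (div_nonneg (sub_nonneg.2 (h' _)) (sub_pos.2 (h _)).le)
      (mem_Icc_iff_facetDist_nonneg.1 hz.1 f')
  · rw [facetDist_boxMap (h _), hz.2, mul_zero]

theorem exists_lineMap_mem_boxFacet [Finite ι] (hg : g ∈ Icc A B) (hy : y ∈ Icc A B)
    (hgy : g ≠ y) : ∃ r : ℝ, 1 ≤ r ∧ ∃ f,
      facetDist A B f y < facetDist A B f g ∧ lineMap g y r ∈ boxFacet A B f := by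
  let d (f : ι × Bool) := facetDist A B f g
  let e (f : ι × Bool) := facetDist A B f y
  -- The ray meets the hyperplane of a facet it approaches at the parameter `d f / (d f - e f)`.
  obtain ⟨f, hf, hmin⟩ : ∃ f ∈ {f | e f < d f}, ∀ f' ∈ {f | e f < d f},
      d f / (d f - e f) ≤ d f' / (d f' - e f') := by
    refine exists_min_image _ _ (toFinite _) ?_
    obtain ⟨i, hi⟩ := Function.ne_iff.1 hgy
    rcases hi.lt_or_gt with hi | hi
    · exact ⟨(i, true), by simpa [d, e, facetDist] using hi⟩
    · exact ⟨(i, false), by simpa [d, e, facetDist] using hi⟩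
  have hd (f) : 0 ≤ d f := mem_Icc_iff_facetDist_nonneg.1 hg f
  have he (f) : 0 ≤ e f := mem_Icc_iff_facetDist_nonneg.1 hy f
  have hpos : 0 < d f - e f := sub_pos.2 hf
  refine ⟨d f / (d f - e f), (one_le_div hpos).2 (sub_le_self _ (he f)), f, hf,
    mem_Icc_iff_facetDist_nonneg.2 fun f' => ?_, ?_⟩
  · rw [facetDist_lineMap, lineMap_apply_ring']
    rcases lt_or_ge (e f') (d f') with hf' | hf'
    · linarith [(le_div_iff₀ (sub_pos.2 hf')).1 (hmin f' hf')]
    · have := mul_nonneg (div_nonneg (hd f) hpos.le) (sub_nonneg.2 hf')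
      exact add_nonneg this (hd f')
  · rw [facetDist_lineMap, lineMap_apply_ring']
    change d f / (d f - e f) * (e f - d f) + d f = 0
    field_simp
    ring

/-- Push `x` away from `o` to a point of a facet, and that point away from a point `g` of `K` in the
same facet to a point of the skeleton. Both `o` and `g` lie in `K`, so illumination carries over
from the last point to `x`. -/
theorem exists_illuminatesAt_of_codimTwoSkeleton [Finite ι] [Nontrivial ι] {K U : Set (ι → ℝ)}
    {o x : ι → ℝ} (hK : Convex ℝ K) (ho : o ∈ interior K) (hoAB : o ∈ Icc A B) (hx : x ∈ Icc A B)
    (hfacet : ∀ f, ∃ g ∈ K ∩ boxFacet A B f, g ≠ x)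
    (hU : ∀ z ∈ codimTwoSkeleton A B, ∃ u ∈ U, IlluminatesAt K u z) :
    ∃ u ∈ U, IlluminatesAt K u x := by
  by_cases hxi : x ∈ interior K
  · obtain ⟨u, hu, -⟩ := hU A (left_mem_codimTwoSkeleton (hx.1.trans hx.2))
    exact ⟨u, hu, illuminatesAt_of_mem_interior hxi u⟩
  have hox : o ≠ x := fun h => hxi (h ▸ ho)
  obtain ⟨t, ht, f, -, hy⟩ := exists_lineMap_mem_boxFacet hoAB hx hox
  set y := lineMap o x t with hy_def
  obtain ⟨g, ⟨hgK, hg⟩, hgx⟩ := hfacet f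
  have hgy : g ≠ y := by
    rintro rfl
    rcases ht.eq_or_lt with rfl | ht
    · exact hgx (by simp [hy_def])
    · refine hxi (hK.openSegment_interior_self_subset_interior ho hgK ?_)
      rw [openSegment_eq_image_lineMap]
      have ht0 : 0 < t := one_pos.trans ht
      exact ⟨t⁻¹, ⟨inv_pos.2 ht0, inv_lt_one_of_one_lt₀ ht⟩, by
        rw [hy_def, lineMap_lineMap_right, inv_mul_cancel₀ ht0.ne', lineMap_apply_one]⟩
  obtain ⟨r, hr, f', hf', hz⟩ := exists_lineMap_mem_boxFacet hg.1 hy.1 hgy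
  have hff' : f.1 ≠ f'.1 := fun h =>
    hf'.ne' (facetDist_congr (h ▸ apply_eq_of_facetDist_eq (hg.2.trans hy.2.symm)))
  have hzf : facetDist A B f (lineMap g y r) = 0 := by
    rw [facetDist_lineMap, hg.2, hy.2, lineMap_same_apply]
  obtain ⟨u, hu, huz⟩ := hU _ ⟨f, f', hff', ⟨hz.1, hzf⟩, hz⟩
  exact ⟨u, hu, (huz.of_lineMap hK hgK hr).of_lineMap hK (interior_subset ho) ht⟩

end Boxes

section BoxesInBody

theorem sum_smul_add_smul_mem_interior {ι E : Type*} [Fintype ι] [TopologicalSpace E]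
    [AddCommGroup E] [IsTopologicalAddGroup E] [Module ℝ E] [ContinuousConstSMul ℝ E] {K : Set E}
    (hK : Convex ℝ K) {o : E} (ho : o ∈ interior K) {s : ι → ℝ} (hs : 0 ≤ s)
    (hsum : ∑ i, s i < 1) {x : ι → E} (hx : ∀ i, x i ∈ K) :
    ∑ i, s i • x i + (1 - ∑ i, s i) • o ∈ interior K := by
  rcases (Finset.sum_nonneg fun i _ => hs i).eq_or_lt with h | h
  · have hz : ∀ i, s i = 0 := fun i =>
      (Finset.sum_eq_zero_iff_of_nonneg fun i _ => hs i).1 h.symm i (Finset.mem_univ i)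
    simpa [hz] using ho
  · rw [← smul_inv_smul₀ h.ne' (∑ i, s i • x i)]
    exact hK.combo_self_interior_mem_interior
      (hK.centerMass_mem (fun i _ => hs i) h fun i _ => hx i) ho h.le (sub_pos.2 hsum) (by ring)

variable {ι : Type*} [Fintype ι] {A B A' B' : ι → ℝ} {K : Set (ι → ℝ)} {N : ℕ∞}

theorem exists_forall_add_mem_interior [DecidableEq ι] (hK : Convex ℝ K)
    (hi : (interior K).Nonempty) (hseg : ∀ i, ∃ p ∈ K, p + Pi.single i 1 ∈ K) {s : ι → ℝ}
    (hs : 0 ≤ s) (hsum : ∑ i, s i < 1) : ∃ w, ∀ q ∈ Icc 0 s, w + q ∈ interior K := by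
  obtain ⟨o, ho⟩ := hi
  choose p hp hp' using hseg
  refine ⟨∑ i, s i • p i + (1 - ∑ i, s i) • o, fun q hq => ?_⟩
  let x (i : ι) : ι → ℝ := p i + (q i / s i) • Pi.single i 1
  have hx (i) : x i ∈ K := hK.add_smul_mem (hp i) (hp' i)
    ⟨div_nonneg (hq.1 i) (hs i), div_le_one_of_le₀ (hq.2 i) (hs i)⟩
  have hsx (i) : s i • x i = s i • p i + Pi.single i (q i) := by
    have h0 : s i = 0 → q i = 0 := fun h => le_antisymm (h ▸ hq.2 i) (hq.1 i)
    rw [smul_add, smul_smul, mul_div_cancel_of_imp' h0, ← Pi.single_smul, smul_eq_mul, mul_one]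
  have := sum_smul_add_smul_mem_interior hK ho hs hsum hx
  rwa [Finset.sum_congr rfl fun i _ => hsx i, Finset.sum_add_distrib, Finset.univ_sum_single,
    add_right_comm] at this

/-- The skeleton of codimension two of the box `Icc A B` can be covered by `N` boxes with side
lengths adding up to less than `1`. Such boxes have translates in the interior of a body in unit
cube position. -/
def SkeletonCoverable (A B : ι → ℝ) (N : ℕ∞) : Prop :=
  ∃ S : Set ((ι → ℝ) × (ι → ℝ)), S.encard ≤ N ∧
    (∀ b ∈ S, b.1 ≤ b.2 ∧ ∑ i, (b.2 i - b.1 i) < 1) ∧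
    codimTwoSkeleton A B ⊆ ⋃ b ∈ S, Icc b.1 b.2

theorem SkeletonCoverable.exists_illuminatesAt [DecidableEq ι] (h : SkeletonCoverable A B N)
    (hK : Convex ℝ K) (hi : (interior K).Nonempty) (hseg : ∀ i, ∃ p ∈ K, p + Pi.single i 1 ∈ K) :
    ∃ U : Set (ι → ℝ), U.encard ≤ N ∧
      ∀ z ∈ codimTwoSkeleton A B, ∃ u ∈ U, IlluminatesAt K u z := by
  obtain ⟨S, hN, hS, hcov⟩ := h
  have hw : ∀ b ∈ S, ∃ w, ∀ q ∈ Icc 0 (b.2 - b.1), w + q ∈ interior K := fun b hb =>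
    exists_forall_add_mem_interior hK hi hseg (sub_nonneg.2 (hS b hb).1) (hS b hb).2
  choose! w hw using hw
  refine ⟨(fun b => w b - b.1) '' S, (encard_image_le _ _).trans hN, fun z hz => ?_⟩
  obtain ⟨b, hb, hzb⟩ := mem_iUnion₂.1 (hcov hz)
  refine ⟨_, mem_image_of_mem _ hb, 1, one_pos, ?_⟩
  convert hw b hb (z - b.1) ⟨sub_nonneg.2 hzb.1, sub_le_sub_right hzb.2 _⟩ using 1
  rw [one_smul]
  abel

theorem SkeletonCoverable.of_sub_le (h : SkeletonCoverable A B N) (h' : ∀ i, A' i < B' i)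
    (hle : B' - A' ≤ B - A) : SkeletonCoverable A' B' N := by
  obtain ⟨S, hN, hS, hcov⟩ := h
  have hlt (i) : A i < B i := sub_pos.1 ((sub_pos.2 (h' i)).trans_le (hle i))
  have hmono : Monotone (boxMap A B A' B') :=
    monotone_boxMap (fun i => (hlt i).le) fun i => (h' i).le
  refine ⟨Prod.map (boxMap A B A' B') (boxMap A B A' B') '' S, (encard_image_le _ _).trans hN,
    ?_, fun z hz => ?_⟩
  · rintro _ ⟨b, hb, rfl⟩
    refine ⟨hmono (hS b hb).1, lt_of_le_of_lt (Finset.sum_le_sum fun i _ => ?_) (hS b hb).2⟩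
    rw [Prod.map_snd, Prod.map_fst, boxMap_apply_sub_boxMap_apply]
    exact mul_le_of_le_one_left (sub_nonneg.2 ((hS b hb).1 i))
      (div_le_one_of_le₀ (hle i) (sub_pos.2 (hlt i)).le)
  · obtain ⟨f, f', hff', hf, hf'⟩ := hz
    obtain ⟨b, hb, hzb⟩ := mem_iUnion₂.1 <| hcov ⟨f, f', hff',
      boxMap_mem_boxFacet h' (fun i => (hlt i).le) hf,
      boxMap_mem_boxFacet h' (fun i => (hlt i).le) hf'⟩
    refine mem_biUnion (mem_image_of_mem _ hb) ?_
    rw [← boxMap_boxMap h' hlt z]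
    exact ⟨hmono hzb.1, hmono hzb.2⟩

end BoxesInBody

section Circumscribed

open AffineMap

variable {ι : Type*} {A B o : ι → ℝ} {K U : Set (ι → ℝ)} {f : ι × Bool}

theorem illuminates_union_range_sub [Finite ι] [Nontrivial ι] (hK : Convex ℝ K)
    (ho : o ∈ interior K) (hoAB : o ∈ Icc A B) {g : ι × Bool → ι → ℝ}
    (hbeyond : ∀ f, ∀ x ∈ K, facetDist A B f x < 0 → IlluminatesAt K (o - g f) x)
    (hfacet : ∀ f, ∃ h ∈ K ∩ boxFacet A B f, h ∈ interior K ∨ h = g f)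
    (hU : ∀ z ∈ codimTwoSkeleton A B, ∃ u ∈ U, IlluminatesAt K u z) :
    Illuminates (U ∪ range fun f => o - g f) K := by
  intro x hx
  by_contra! hdark
  have hdark' (f) : ¬IlluminatesAt K (o - g f) x := hdark _ (.inr (mem_range_self f))
  have hxAB : x ∈ Icc A B := mem_Icc_iff_facetDist_nonneg.2 fun f =>
    le_of_not_gt fun hf => hdark' f (hbeyond f x hx hf)
  have hfacet' (f) : ∃ h ∈ K ∩ boxFacet A B f, h ≠ x := by
    obtain ⟨h, hh, hi⟩ := hfacet f
    refine ⟨h, hh, ?_⟩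
    rintro rfl
    rcases hi with hi | rfl
    · exact hdark' f (illuminatesAt_of_mem_interior hi _)
    · exact hdark' f (illuminatesAt_sub ho _)
  obtain ⟨u, hu, h⟩ :=
    exists_illuminatesAt_of_codimTwoSkeleton hK ho hoAB hxAB hfacet' hU
  exact hdark u (.inl hu) h

theorem exists_mem_boxFacet_imp_nontrivial (hK : Convex ℝ K) (hKAB : K ⊆ Icc A B)
    (hf : (K ∩ boxFacet A B f).Nontrivial) :
    ∃ g ∈ K ∩ boxFacet A B f, ∀ f', g ∈ boxFacet A B f' → (K ∩ boxFacet A B f').Nontrivial := by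
  obtain ⟨a, ⟨ha, haf⟩, b, ⟨hb, hbf⟩, hab⟩ := hf
  have hm : midpoint ℝ a b ∈ K := hK.midpoint_mem ha hb
  have hdist (f') : facetDist A B f' (midpoint ℝ a b) =
      (facetDist A B f' a + facetDist A B f' b) / 2 := by
    rw [midpoint, facetDist_lineMap, lineMap_apply_ring', invOf_eq_inv]
    ring
  refine ⟨_, ⟨hm, hKAB hm, by rw [hdist, haf.2, hbf.2, add_zero, zero_div]⟩, fun f' hf' => ?_⟩
  have h0 := hf'.2
  rw [hdist] at h0
  have ha0 := mem_Icc_iff_facetDist_nonneg.1 (hKAB ha) f'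
  have hb0 := mem_Icc_iff_facetDist_nonneg.1 (hKAB hb) f'
  exact ⟨a, ⟨ha, hKAB ha, by linarith⟩, b, ⟨hb, hKAB hb, by linarith⟩, hab⟩

theorem eventually_illuminatesAt_of_subsingleton (hc : IsCompact K) (hKAB : K ⊆ Icc A B)
    (ho : o ∈ interior K) {g : ι → ℝ} (hg : g ∈ K ∩ boxFacet A B f)
    (hf : (K ∩ boxFacet A B f).Subsingleton) {c : ℝ} (hpos : 0 < c) :
    ∀ᶠ ε in 𝓝[>] (0 : ℝ), ∀ x ∈ K, facetDist A B f x < ε * c → IlluminatesAt K (o - g) x := by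
  obtain ⟨δ, hδ, h⟩ := (hc.diff (isOpen_setOf_illuminatesAt K (o - g))).exists_forall_le'
    (a := 0) (continuous_facetDist A B f).continuousOn fun x hx => by
      refine (mem_Icc_iff_facetDist_nonneg.1 (hKAB hx.1) f).lt_of_ne fun h0 => hx.2 ?_
      rw [hf ⟨hx.1, hKAB hx.1, h0.symm⟩ hg]
      exact illuminatesAt_sub ho g
  filter_upwards [Ioo_mem_nhdsGT (div_pos hδ hpos)] with ε hε x hx hxε
  by_contra hdark
  exact (h x ⟨hx, hdark⟩).not_gt (hxε.trans ((lt_div_iff₀ hpos).1 hε.2))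

/-- How far the facet `f` of the box `Icc A B` is moved inwards: just past the point of `K` in the
facet if there is only one such point. Multiples of the distances to `o` make the convex
combinations of points of `K` with `o` stay in the smaller box. -/
noncomputable def facetInset (K : Set (ι → ℝ)) (A B o : ι → ℝ) (ε : ℝ) (f : ι × Bool) : ℝ :=
  open Classical in if (K ∩ boxFacet A B f).Subsingleton then ε * facetDist A B f o else 0

/-- The lower corner of the box obtained from `Icc A B` by moving each facet `f` inwards by
`η f`. -/
def insetLower (A : ι → ℝ) (η : ι × Bool → ℝ) (i : ι) : ℝ :=
  A i + η (i, false)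

/-- The upper corner of the box obtained from `Icc A B` by moving each facet `f` inwards by
`η f`. -/
def insetUpper (B : ι → ℝ) (η : ι × Bool → ℝ) (i : ι) : ℝ :=
  B i - η (i, true)

theorem facetDist_inset (A B : ι → ℝ) (η : ι × Bool → ℝ) (f : ι × Bool) (z : ι → ℝ) :
    facetDist (insetLower A η) (insetUpper B η) f z = facetDist A B f z - η f := by
  obtain ⟨i, _ | _⟩ := f
  · simp only [facetDist, insetLower, Bool.false_eq_true, if_false]
    ring
  · simp only [facetDist, insetUpper, if_true]
    ring

theorem insetUpper_apply_sub_insetLower_apply (A B : ι → ℝ) (η : ι × Bool → ℝ) (i : ι) :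
    insetUpper B η i - insetLower A η i = B i - A i - (η (i, false) + η (i, true)) := by
  unfold insetUpper insetLower
  ring

theorem facetInset_nonneg {ε : ℝ} (hε : 0 ≤ ε) (ho : o ∈ Icc A B) (f : ι × Bool) :
    0 ≤ facetInset K A B o ε f := by
  unfold facetInset
  split_ifs
  · exact mul_nonneg hε (mem_Icc_iff_facetDist_nonneg.1 ho f)
  · exact le_rfl

theorem facetInset_le {ε : ℝ} (hε : 0 ≤ ε) (ho : o ∈ Icc A B) (f : ι × Bool) :
    facetInset K A B o ε f ≤ ε * facetDist A B f o := by
  unfold facetInset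
  split_ifs
  · exact le_rfl
  · exact mul_nonneg hε (mem_Icc_iff_facetDist_nonneg.1 ho f)

theorem mem_inset_iff {η : ι × Bool → ℝ} {z : ι → ℝ} :
    z ∈ Icc (insetLower A η) (insetUpper B η) ↔ ∀ f, η f ≤ facetDist A B f z := by
  simp only [mem_Icc_iff_facetDist_nonneg, facetDist_inset, sub_nonneg]

theorem mem_boxFacet_inset_iff {η : ι × Bool → ℝ} {z : ι → ℝ} :
    z ∈ boxFacet (insetLower A η) (insetUpper B η) f ↔
      (∀ f, η f ≤ facetDist A B f z) ∧ facetDist A B f z = η f := by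
  rw [boxFacet, mem_sep_iff, mem_inset_iff, facetDist_inset, sub_eq_zero]

theorem lineMap_mem_boxFacet_inset {g : ι → ℝ} {ε : ℝ} (hε : 0 ≤ ε) (hε1 : ε ≤ 1)
    (ho : o ∈ Icc A B) (hg : g ∈ K ∩ boxFacet A B f) (hf : (K ∩ boxFacet A B f).Subsingleton) :
    lineMap g o ε ∈ boxFacet (insetLower A (facetInset K A B o ε))
      (insetUpper B (facetInset K A B o ε)) f := by
  refine mem_boxFacet_inset_iff.2 ⟨fun f' => (facetInset_le hε ho f').trans ?_, ?_⟩
  · rw [facetDist_lineMap, lineMap_apply_ring]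
    have := mul_nonneg (sub_nonneg.2 hε1) (mem_Icc_iff_facetDist_nonneg.1 hg.2.1 f')
    linarith
  · rw [facetDist_lineMap, hg.2.2, lineMap_apply_ring, facetInset, if_pos hf]
    ring

theorem mem_boxFacet_inset {g : ι → ℝ} {ε : ℝ} (hg : g ∈ K ∩ boxFacet A B f)
    (hf : ¬(K ∩ boxFacet A B f).Subsingleton)
    (hε : ∀ f', (K ∩ boxFacet A B f').Subsingleton → ε * facetDist A B f' o ≤ facetDist A B f' g) :
    g ∈ boxFacet (insetLower A (facetInset K A B o ε)) (insetUpper B (facetInset K A B o ε)) f := by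
  refine mem_boxFacet_inset_iff.2 ⟨fun f' => ?_, by rw [hg.2.2, facetInset, if_neg hf]⟩
  unfold facetInset
  split_ifs with hf'
  · exact hε f' hf'
  · exact mem_Icc_iff_facetDist_nonneg.1 hg.2.1 f'

theorem exists_forall_mem_boxFacet_forall_pos (hK : Convex ℝ K) (hKAB : K ⊆ Icc A B)
    (hne : ∀ f, (K ∩ boxFacet A B f).Nonempty) :
    ∃ g : ι × Bool → ι → ℝ, ∀ f, g f ∈ K ∩ boxFacet A B f ∧
      (¬(K ∩ boxFacet A B f).Subsingleton → ∀ f', (K ∩ boxFacet A B f').Subsingleton →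
        0 < facetDist A B f' (g f)) := by
  suffices ∀ f, ∃ x ∈ K ∩ boxFacet A B f, ¬(K ∩ boxFacet A B f).Subsingleton →
      ∀ f', (K ∩ boxFacet A B f').Subsingleton → 0 < facetDist A B f' x by
    choose g hg hg' using this
    exact ⟨g, fun f => ⟨hg f, hg' f⟩⟩
  intro f
  by_cases hf : (K ∩ boxFacet A B f).Subsingleton
  · obtain ⟨g, hg⟩ := hne f
    exact ⟨g, hg, fun h => absurd hf h⟩
  · obtain ⟨g, hg, hg'⟩ :=
      exists_mem_boxFacet_imp_nontrivial hK hKAB (not_subsingleton_iff.1 hf)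
    refine ⟨g, hg, fun _ f' hf' => ?_⟩
    refine (mem_Icc_iff_facetDist_nonneg.1 hg.2.1 f').lt_of_ne fun h0 => ?_
    exact (hg' f' ⟨hg.2.1, h0.symm⟩).not_subsingleton hf'

theorem encard_union_range_le {α κ : Type*} [Fintype κ] {U : Set α} {N : ℕ∞} (hU : U.encard ≤ N)
    (d : κ → α) : (U ∪ range d).encard ≤ N + Fintype.card κ := by
  refine (encard_union_le _ _).trans (add_le_add hU ?_)
  rw [← image_univ]
  exact (encard_image_le _ _).trans_eq (by simp)

theorem exists_illuminates_union_range_sub [Finite ι] [Nontrivial ι] (hc : IsCompact K)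
    (hK : Convex ℝ K) (hKAB : K ⊆ Icc A B) (hne : ∀ f, (K ∩ boxFacet A B f).Nonempty)
    (ho : o ∈ interior K) :
    ∃ g : ι × Bool → ι → ℝ, ∃ ε ∈ Ioo (0 : ℝ) 1, ∀ U : Set (ι → ℝ),
      (∀ z ∈ codimTwoSkeleton (insetLower A (facetInset K A B o ε))
        (insetUpper B (facetInset K A B o ε)), ∃ u ∈ U, IlluminatesAt K u z) →
      Illuminates (U ∪ range fun f => o - g f) K := by
  obtain ⟨g, hg⟩ := exists_forall_mem_boxFacet_forall_pos hK hKAB hne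
  have hoAB : o ∈ Icc A B := hKAB (interior_subset ho)
  have hpos (f) : 0 < facetDist A B f o :=
    facetDist_pos_of_mem_interior (interior_mono hKAB ho) f
  have hlight : ∀ᶠ ε in 𝓝[>] (0 : ℝ), ∀ f, (K ∩ boxFacet A B f).Subsingleton →
      ∀ x ∈ K, facetDist A B f x < ε * facetDist A B f o → IlluminatesAt K (o - g f) x := by
    simp only [eventually_all]
    exact fun f hf => eventually_illuminatesAt_of_subsingleton hc hKAB ho (hg f).1 hf (hpos f)
  have havoid : ∀ᶠ ε in 𝓝[>] (0 : ℝ), ∀ f, ¬(K ∩ boxFacet A B f).Subsingleton →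
      ∀ f', (K ∩ boxFacet A B f').Subsingleton →
        ε * facetDist A B f' o ≤ facetDist A B f' (g f) := by
    simp only [eventually_all]
    intro f hf f' hf'
    filter_upwards [Ioo_mem_nhdsGT (div_pos ((hg f).2 hf f' hf') (hpos f'))] with ε hε
    exact ((lt_div_iff₀ (hpos f')).1 hε.2).le
  obtain ⟨ε, ⟨hlight, havoid⟩, hε⟩ :=
    ((hlight.and havoid).and (Ioo_mem_nhdsGT (zero_lt_one' ℝ))).exists
  refine ⟨g, ε, hε, fun U => illuminates_union_range_sub hK ho
    (mem_inset_iff.2 fun f => (facetInset_le hε.1.le hoAB f).trans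
      (mul_le_of_le_one_left (hpos f).le hε.2.le)) (fun f x hx hxf => ?_) fun f => ?_⟩
  · rw [facetDist_inset, sub_neg, facetInset] at hxf
    split_ifs at hxf with hf
    · exact hlight f hf x hx hxf
    · exact absurd hxf (mem_Icc_iff_facetDist_nonneg.1 (hKAB hx) f).not_gt
  · by_cases hf : (K ∩ boxFacet A B f).Subsingleton
    · have hi : lineMap (g f) o ε ∈ interior K := by
        rw [lineMap_apply_module]
        exact hK.combo_self_interior_mem_interior (hg f).1.1 ho (sub_nonneg.2 hε.2.le) hε.1
          (by ring)
      exact ⟨_, ⟨interior_subset hi, lineMap_mem_boxFacet_inset hε.1.le hε.2.le hoAB (hg f).1 hf⟩,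
        .inl hi⟩
    · exact ⟨g f, ⟨(hg f).1.1, mem_boxFacet_inset (hg f).1 hf (havoid f hf)⟩, .inr rfl⟩

end Circumscribed

namespace InUnitCubePosition

variable {ι : Type*} [DecidableEq ι] {K : Set (ι → ℝ)} {N : ℕ∞}

theorem inter_boxFacet_nonempty (hK : InUnitCubePosition K) (f : ι × Bool) :
    (K ∩ boxFacet 0 1 f).Nonempty := by
  obtain ⟨i, b⟩ := f
  obtain ⟨p, hp, hp'⟩ := hK.exists_segment i
  have h0 : 0 ≤ p i := (hK.subset_Icc hp).1 i
  have h1 : p i + 1 ≤ 1 := by simpa using (hK.subset_Icc hp').2 i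
  have hpi : p i = 0 := by linarith
  cases b
  · exact ⟨p, hp, hK.subset_Icc hp, by simp [facetDist, hpi]⟩
  · exact ⟨_, hp', hK.subset_Icc hp', by simp [facetDist, hpi]⟩

variable [Fintype ι] [Nontrivial ι]

theorem exists_illuminates_of_nontrivial (hK : InUnitCubePosition K)
    (hS : SkeletonCoverable (0 : ι → ℝ) 1 N) (hF : ∀ f, (K ∩ boxFacet 0 1 f).Nontrivial) :
    ∃ U : Set (ι → ℝ), U.encard ≤ N ∧ Illuminates U K := by
  obtain ⟨U, hUN, hU⟩ :=
    hS.exists_illuminatesAt hK.convex hK.interior_nonempty hK.exists_segment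
  obtain ⟨o, ho⟩ := hK.interior_nonempty
  exact ⟨U, hUN, fun x hx => exists_illuminatesAt_of_codimTwoSkeleton hK.convex ho
    (hK.subset_Icc (interior_subset ho)) (hK.subset_Icc hx) (fun f => (hF f).exists_ne x) hU⟩

theorem exists_illuminates (hK : InUnitCubePosition K)
    (hS : SkeletonCoverable (0 : ι → ℝ) 1 N) :
    ∃ U : Set (ι → ℝ), U.encard ≤ N + Fintype.card (ι × Bool) ∧ Illuminates U K := by
  obtain ⟨U, hUN, hU⟩ :=
    hS.exists_illuminatesAt hK.convex hK.interior_nonempty hK.exists_segment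
  obtain ⟨o, ho⟩ := hK.interior_nonempty
  choose g hg using hK.inter_boxFacet_nonempty
  refine ⟨U ∪ range fun f => o - g f, encard_union_range_le hUN _,
    illuminates_union_range_sub hK.convex ho (hK.subset_Icc (interior_subset ho))
      (fun f x hx hxf => ?_) (fun f => ⟨g f, hg f, .inr rfl⟩) hU⟩
  exact absurd hxf (mem_Icc_iff_facetDist_nonneg.1 (hK.subset_Icc hx) f).not_gt

/-- If a facet of the cube contains only one point of `K`, then a direction assigned to this point
also illuminates the points near the facet, and the rest of `K` lies in a shorter box. -/
theorem exists_illuminates_of_subsingleton (hK : InUnitCubePosition K)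
    {f : ι × Bool} (hf : (K ∩ boxFacet 0 1 f).Subsingleton)
    (hS : ∀ ℓ ∈ Ioo (0 : ℝ) 1, SkeletonCoverable (0 : ι → ℝ) (Function.update 1 f.1 ℓ) N) :
    ∃ U : Set (ι → ℝ), U.encard ≤ N + Fintype.card (ι × Bool) ∧ Illuminates U K := by
  obtain ⟨o, ho⟩ := hK.interior_nonempty
  obtain ⟨g, ε, hε, hg⟩ := exists_illuminates_union_range_sub hK.isCompact hK.convex
    hK.subset_Icc hK.inter_boxFacet_nonempty ho
  have ho01 : o ∈ Icc (0 : ι → ℝ) 1 := hK.subset_Icc (interior_subset ho)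
  set η := facetInset K 0 1 o ε with hη
  have hη0 (f) : 0 ≤ η f := facetInset_nonneg hε.1.le ho01 f
  have hηle (i) : η (i, false) + η (i, true) ≤ ε := by
    have h := add_le_add (facetInset_le (K := K) hε.1.le ho01 (i, false))
      (facetInset_le (K := K) hε.1.le ho01 (i, true))
    simpa [facetDist, ← mul_add] using h
  have hηf : 0 < η f := by
    rw [hη, facetInset, if_pos hf]
    exact mul_pos hε.1 (facetDist_pos_of_mem_interior (interior_mono hK.subset_Icc ho) f)
  have hlength (i) : insetUpper 1 η i - insetLower 0 η i = 1 - (η (i, false) + η (i, true)) := by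
    rw [insetUpper_apply_sub_insetLower_apply, Pi.one_apply, Pi.zero_apply, sub_zero]
  have hηf' : 0 < η (f.1, false) + η (f.1, true) := by
    obtain ⟨i, _ | _⟩ := f
    · exact add_pos_of_pos_of_nonneg hηf (hη0 _)
    · exact add_pos_of_nonneg_of_pos (hη0 _) hηf
  have hcov := (hS (1 - (η (f.1, false) + η (f.1, true)))
    ⟨by linarith [hηle f.1, hε.2], by linarith⟩).of_sub_le (A' := insetLower 0 η)
    (B' := insetUpper 1 η) (fun i => by linarith [hηle i, hε.2, hlength i]) fun i => by
      rw [Pi.sub_apply, hlength, sub_zero]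
      rcases eq_or_ne i f.1 with rfl | hi
      · rw [Function.update_self]
      · rw [Function.update_of_ne hi, Pi.one_apply]
        linarith [hη0 (i, false), hη0 (i, true)]
  obtain ⟨U, hUN, hU⟩ :=
    hcov.exists_illuminatesAt hK.convex hK.interior_nonempty hK.exists_segment
  exact ⟨_, encard_union_range_le hUN _, hg U hU⟩

end InUnitCubePosition

section Layers

theorem exists_mem_Icc_of_le_of_le {α : Type*} [LinearOrder α] {f : ℕ → α} {t : α} {m : ℕ}
    (hm : 0 < m) (h0 : f 0 ≤ t) (ht : t ≤ f m) : ∃ k < m, t ∈ Icc (f k) (f (k + 1)) := by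
  induction m, hm using Nat.le_induction with
  | base => exact ⟨0, one_pos, h0, ht⟩
  | succ m _ ih =>
    rcases le_total (f m) t with h | h
    · exact ⟨m, m.lt_succ_self, h, ht⟩
    · obtain ⟨k, hk, hkt⟩ := ih h
      exact ⟨k, hk.trans m.lt_succ_self, hkt⟩

theorem SkeletonCoverable.mono {ι : Type*} [Fintype ι] {A B : ι → ℝ} {M N : ℕ∞}
    (h : SkeletonCoverable A B M) (hMN : M ≤ N) : SkeletonCoverable A B N := by
  obtain ⟨S, hS, h⟩ := h
  exact ⟨S, hS.trans hMN, h⟩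

variable {ι 𝕜 : Type*} [Fintype ι] [DecidableEq ι]

/-- The sets of coordinate directions that are parallel to the faces of codimension at least two of
a box. -/
def faceDirections (ι : Type*) [Fintype ι] [DecidableEq ι] : Finset (Finset ι) :=
  {L | L.card + 2 ≤ Fintype.card ι}

theorem mem_faceDirections {L : Finset ι} :
    L ∈ faceDirections ι ↔ L.card + 2 ≤ Fintype.card ι := by
  simp [faceDirections]

theorem erase_mem_faceDirections {L : Finset ι} (hL : L ∈ faceDirections ι) (i : ι) :
    L.erase i ∈ faceDirections ι := by
  have := Finset.card_erase_le (s := L) (a := i)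
  rw [mem_faceDirections] at hL ⊢
  omega

theorem compl_pair_mem_faceDirections {i j : ι} (hij : i ≠ j) : {i, j}ᶜ ∈ faceDirections ι := by
  have := Finset.card_add_card_compl {i, j}
  rw [Finset.card_pair hij] at this
  exact mem_faceDirections.2 (by omega)

/-- Numbers describing a covering of the skeleton of codimension two of the box `Icc 0 ℓ`. The
boxes along a face with directions `L` have width `a L j` in the directions `j ∉ L`. In a direction
`i ∈ L`, the part of the face outside of the boxes along the two smaller faces with directions
`L.erase i` is cut into `m L i` pieces. -/
structure IsLayering [Field 𝕜] [LinearOrder 𝕜] (ℓ : ι → 𝕜) (a : Finset ι → ι → 𝕜)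
    (m : Finset ι → ι → ℕ) : Prop where
  nonneg : ∀ L ∈ faceDirections ι, ∀ j ∉ L, 0 ≤ a L j
  anti : ∀ L ∈ faceDirections ι, ∀ i ∈ L, ∀ j ∉ L, a L j ≤ a (L.erase i) j
  le_length : ∀ L ∈ faceDirections ι, ∀ i ∈ L, 2 * a (L.erase i) i ≤ ℓ i
  pos : ∀ L ∈ faceDirections ι, ∀ i ∈ L, 0 < m L i

/-- The side lengths of the boxes of a layering along a face with directions `L`. -/
def layerSide [Field 𝕜] (ℓ : ι → 𝕜) (a : Finset ι → ι → 𝕜) (m : Finset ι → ι → ℕ)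
    (L : Finset ι) (i : ι) : 𝕜 :=
  if i ∈ L then (ℓ i - 2 * a (L.erase i) i) / m L i else a L i

/-- The number of positions, in the direction `i`, of the boxes of a layering along the faces with
directions `L`: in a direction `i ∉ L`, there are two parallel faces. -/
def layerPositions (m : Finset ι → ι → ℕ) (L : Finset ι) (i : ι) : ℕ :=
  if i ∈ L then m L i else 2

/-- The number of boxes of a layering. -/
def layerCount (m : Finset ι → ι → ℕ) : ℕ :=
  ∑ L ∈ faceDirections ι, ∏ i, layerPositions m L i

/-- The lower corner of the box with position `k` of a layering along the faces with directions
`L`. -/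
def layerCorner [Field 𝕜] (ℓ : ι → 𝕜) (a : Finset ι → ι → 𝕜) (m : Finset ι → ι → ℕ)
    (L : Finset ι) (k : ι → ℕ) (i : ι) : 𝕜 :=
  if i ∈ L then a (L.erase i) i + k i * layerSide ℓ a m L i else if k i = 0 then 0 else ℓ i - a L i

variable {m : Finset ι → ι → ℕ}

section LinearOrderedField

variable [Field 𝕜] [LinearOrder 𝕜] {ℓ : ι → 𝕜} {a : Finset ι → ι → 𝕜} {L : Finset ι}

/-- A minimal set `L` with the property assumed in `hd` satisfies the last condition as well. -/
theorem IsLayering.exists_faceDirections (h : IsLayering ℓ a m) {d : ι → 𝕜}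
    (hd : ∃ L ∈ faceDirections ι, ∀ j ∉ L, d j ≤ a L j) :
    ∃ L ∈ faceDirections ι, (∀ j ∉ L, d j ≤ a L j) ∧ ∀ i ∈ L, a (L.erase i) i ≤ d i := by
  obtain ⟨L, ⟨hL, hout⟩, hmin⟩ :=
    (Set.toFinite {L ∈ faceDirections ι | ∀ j ∉ L, d j ≤ a L j}).exists_minimal hd
  refine ⟨L, hL, hout, fun i hi => ?_⟩
  by_contra! hlt
  have hle : L ⊆ L.erase i := hmin ⟨erase_mem_faceDirections hL i, fun j hj => ?_⟩
    (L.erase_subset i)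
  · exact Finset.notMem_erase i L (hle hi)
  · rcases eq_or_ne j i with rfl | hji
    · exact hlt.le
    · have hjL : j ∉ L := fun hjL => hj (Finset.mem_erase.2 ⟨hji, hjL⟩)
      exact (hout j hjL).trans (h.anti L hL i hi j hjL)

variable [IsStrictOrderedRing 𝕜]

theorem IsLayering.layerSide_nonneg (h : IsLayering ℓ a m) (hL : L ∈ faceDirections ι) :
    0 ≤ layerSide ℓ a m L := fun i => by
  unfold layerSide
  split_ifs with hi
  · exact div_nonneg (sub_nonneg.2 (h.le_length L hL i hi)) (Nat.cast_nonneg _)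
  · exact h.nonneg L hL i hi

theorem IsLayering.exists_position (h : IsLayering ℓ a m) (hL : L ∈ faceDirections ι) {z : ι → 𝕜}
    (hz : z ∈ Icc 0 ℓ) (hout : ∀ j ∉ L, min (z j) (ℓ j - z j) ≤ a L j)
    (hin : ∀ i ∈ L, a (L.erase i) i ≤ min (z i) (ℓ i - z i)) (i : ι) :
    ∃ n < layerPositions m L i, ∀ k : ι → ℕ, k i = n →
      z i ∈ Icc (layerCorner ℓ a m L k i) (layerCorner ℓ a m L k i + layerSide ℓ a m L i) := by
  by_cases hi : i ∈ L
  · have hm : (m L i : 𝕜) ≠ 0 := Nat.cast_ne_zero.2 (h.pos L hL i hi).ne'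
    obtain ⟨hz0, hzℓ⟩ := le_min_iff.1 (hin i hi)
    obtain ⟨n, hn, hzn⟩ := exists_mem_Icc_of_le_of_le
      (f := fun n => a (L.erase i) i + n * layerSide ℓ a m L i) (h.pos L hL i hi)
      (by simpa using hz0) (by
        rw [layerSide, if_pos hi, mul_div_cancel₀ _ hm]
        linarith)
    refine ⟨n, by rwa [layerPositions, if_pos hi], ?_⟩
    rintro k rfl
    simpa only [layerCorner, if_pos hi, Nat.cast_succ, add_mul, one_mul, ← add_assoc] using hzn
  · simp only [layerPositions, layerCorner, layerSide, if_neg hi]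
    rcases min_le_iff.1 (hout i hi) with hzi | hzi
    · refine ⟨0, two_pos, fun k hk => ?_⟩
      rw [if_pos hk, zero_add]
      exact ⟨hz.1 i, hzi⟩
    · refine ⟨1, one_lt_two, fun k hk => ?_⟩
      rw [if_neg (hk.trans_ne one_ne_zero), sub_add_cancel]
      exact ⟨sub_le_comm.1 hzi, hz.2 i⟩

end LinearOrderedField

/-- The pairs of directions and positions of the boxes of a layering. -/
def layerIndices (m : Finset ι → ι → ℕ) : Finset (Σ _ : Finset ι, ι → ℕ) :=
  (faceDirections ι).sigma fun L => Fintype.piFinset fun i => Finset.range (layerPositions m L i)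

theorem card_layerIndices (m : Finset ι → ι → ℕ) : (layerIndices m).card = layerCount m := by
  simp [layerIndices, layerCount, Finset.card_sigma, Fintype.card_piFinset]

theorem IsLayering.skeletonCoverable {ℓ : ι → ℝ} {a : Finset ι → ι → ℝ} (h : IsLayering ℓ a m)
    (hsum : ∀ L ∈ faceDirections ι, ∑ i, layerSide ℓ a m L i < 1) :
    SkeletonCoverable 0 ℓ (layerCount m) := by
  let box (p : Σ _ : Finset ι, ι → ℕ) : (ι → ℝ) × (ι → ℝ) :=
    (layerCorner ℓ a m p.1 p.2, layerCorner ℓ a m p.1 p.2 + layerSide ℓ a m p.1)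
  refine ⟨box '' layerIndices m, ?_, ?_, ?_⟩
  · rw [← card_layerIndices, ← encard_coe_eq_coe_finsetCard]
    exact encard_image_le _ _
  · rintro _ ⟨⟨L, k⟩, hp, rfl⟩
    have hL := (Finset.mem_sigma.1 hp).1
    exact ⟨le_add_of_nonneg_right (h.layerSide_nonneg hL), by simpa [box] using hsum L hL⟩
  · rintro z ⟨f, f', hff', hf, hf'⟩
    have hmin {f : ι × Bool} (hf : z ∈ boxFacet 0 ℓ f) : min (z f.1) (ℓ f.1 - z f.1) ≤ 0 := by
      have := hf.2
      unfold facetDist at this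
      split_ifs at this
      · exact (min_le_right _ _).trans_eq this
      · exact (min_le_left _ _).trans_eq (by simpa using this)
    obtain ⟨L, hL, hout, hin⟩ := h.exists_faceDirections (d := fun i => min (z i) (ℓ i - z i))
      ⟨_, compl_pair_mem_faceDirections hff', fun j hj => by
        refine le_trans ?_ (h.nonneg _ (compl_pair_mem_faceDirections hff') j hj)
        simp only [Finset.mem_compl, Finset.mem_insert, Finset.mem_singleton, not_not] at hj
        rcases hj with rfl | rfl
        exacts [hmin hf, hmin hf']⟩
    choose k hk hzk using h.exists_position hL hf.1 hout hin
    have hp : (⟨L, k⟩ : Σ _ : Finset ι, ι → ℕ) ∈ layerIndices m :=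
      Finset.mem_sigma.2 ⟨hL, Fintype.mem_piFinset.2 fun i => Finset.mem_range.2 (hk i)⟩
    exact mem_biUnion (mem_image_of_mem box hp)
      ⟨fun i => (hzk i k rfl).1, fun i => (hzk i k rfl).2⟩

theorem IsLayering.combo [Field 𝕜] [LinearOrder 𝕜] [IsStrictOrderedRing 𝕜] {ℓ₀ ℓ₁ : ι → 𝕜}
    {a₀ a₁ : Finset ι → ι → 𝕜} {s t : 𝕜} (h₀ : IsLayering ℓ₀ a₀ m) (h₁ : IsLayering ℓ₁ a₁ m)
    (hs : 0 ≤ s) (ht : 0 ≤ t) : IsLayering (s • ℓ₀ + t • ℓ₁) (s • a₀ + t • a₁) m where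
  nonneg L hL j hj :=
    add_nonneg (mul_nonneg hs (h₀.nonneg L hL j hj)) (mul_nonneg ht (h₁.nonneg L hL j hj))
  anti L hL i hi j hj := add_le_add (mul_le_mul_of_nonneg_left (h₀.anti L hL i hi j hj) hs)
    (mul_le_mul_of_nonneg_left (h₁.anti L hL i hi j hj) ht)
  le_length L hL i hi := by
    have := add_le_add (mul_le_mul_of_nonneg_left (h₀.le_length L hL i hi) hs)
      (mul_le_mul_of_nonneg_left (h₁.le_length L hL i hi) ht)
    simp only [Pi.add_apply, Pi.smul_apply, smul_eq_mul]
    linarith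
  pos := h₀.pos

theorem sum_layerSide_combo [Field 𝕜] (ℓ₀ ℓ₁ : ι → 𝕜) (a₀ a₁ : Finset ι → ι → 𝕜)
    (m : Finset ι → ι → ℕ) (s t : 𝕜) (L : Finset ι) :
    ∑ i, layerSide (s • ℓ₀ + t • ℓ₁) (s • a₀ + t • a₁) m L i =
      s * ∑ i, layerSide ℓ₀ a₀ m L i + t * ∑ i, layerSide ℓ₁ a₁ m L i := by
  rw [Finset.mul_sum, Finset.mul_sum, ← Finset.sum_add_distrib]
  refine Finset.sum_congr rfl fun i _ => ?_
  simp only [layerSide, Pi.add_apply, Pi.smul_apply, smul_eq_mul]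
  split_ifs <;> ring

theorem IsLayering.skeletonCoverable_combo {ℓ₀ ℓ₁ : ι → ℝ} {a₀ a₁ : Finset ι → ι → ℝ}
    {s t : ℝ} (h₀ : IsLayering ℓ₀ a₀ m) (h₁ : IsLayering ℓ₁ a₁ m)
    (hsum₀ : ∀ L ∈ faceDirections ι, ∑ i, layerSide ℓ₀ a₀ m L i ≤ 1)
    (hsum₁ : ∀ L ∈ faceDirections ι, ∑ i, layerSide ℓ₁ a₁ m L i < 1)
    (hs : 0 ≤ s) (ht : 0 < t) (hst : s + t = 1) :
    SkeletonCoverable 0 (s • ℓ₀ + t • ℓ₁) (layerCount m) := by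
  refine (h₀.combo h₁ hs ht.le).skeletonCoverable fun L hL => ?_
  rw [sum_layerSide_combo]
  linarith [mul_le_mul_of_nonneg_left (hsum₀ L hL) hs, mul_lt_mul_of_pos_left (hsum₁ L hL) ht]

theorem IsLayering.ratCast {ℓ : ι → ℚ} {a : Finset ι → ι → ℚ} (h : IsLayering ℓ a m) :
    IsLayering (fun i => (ℓ i : ℝ)) (fun L i => (a L i : ℝ)) m where
  nonneg L hL j hj := Rat.cast_nonneg.2 (h.nonneg L hL j hj)
  anti L hL i hi j hj := Rat.cast_le.2 (h.anti L hL i hi j hj)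
  le_length L hL i hi := by exact_mod_cast h.le_length L hL i hi
  pos := h.pos

theorem sum_layerSide_ratCast (ℓ : ι → ℚ) (a : Finset ι → ι → ℚ) (m : Finset ι → ι → ℕ)
    (L : Finset ι) : ∑ i, layerSide (fun i => (ℓ i : ℝ)) (fun L i => (a L i : ℝ)) m L i =
      (∑ i, layerSide ℓ a m L i : ℚ) := by
  simp only [layerSide]
  push_cast
  exact Finset.sum_congr rfl fun i _ => by split_ifs <;> push_cast <;> rfl

theorem IsLayering.skeletonCoverable_one {a : Finset ι → ι → ℚ} (h : IsLayering 1 a m)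
    (hsum : ∀ L ∈ faceDirections ι, ∑ i, layerSide 1 a m L i < 1) :
    SkeletonCoverable (0 : ι → ℝ) 1 (layerCount m) := by
  have hcast : (fun i => ((1 : ι → ℚ) i : ℝ)) = 1 := funext fun _ => Rat.cast_one
  rw [← hcast]
  exact h.ratCast.skeletonCoverable fun L hL => by
    rw [sum_layerSide_ratCast]
    exact_mod_cast hsum L hL

theorem IsLayering.skeletonCoverable_update {k : ι} {a₀ a₁ : Finset ι → ι → ℚ}
    (h₀ : IsLayering (Function.update 1 k 0) a₀ m) (h₁ : IsLayering 1 a₁ m)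
    (hsum₀ : ∀ L ∈ faceDirections ι, ∑ i, layerSide (Function.update 1 k 0) a₀ m L i < 1)
    (hsum₁ : ∀ L ∈ faceDirections ι, ∑ i, layerSide 1 a₁ m L i ≤ 1) {ℓ : ℝ} (hℓ : ℓ ∈ Ico 0 1) :
    SkeletonCoverable 0 (Function.update 1 k ℓ) (layerCount m) := by
  have hcombo : Function.update (1 : ι → ℝ) k ℓ = ℓ • (fun i => ((1 : ι → ℚ) i : ℝ)) +
      (1 - ℓ) • fun i => (Function.update (1 : ι → ℚ) k 0 i : ℝ) := by
    ext i
    rcases eq_or_ne i k with rfl | hik <;> simp [*]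
  rw [hcombo]
  refine h₁.ratCast.skeletonCoverable_combo h₀.ratCast (fun L hL => ?_) (fun L hL => ?_) hℓ.1
    (sub_pos.2 hℓ.2) (add_sub_cancel _ _) <;> rw [sum_layerSide_ratCast]
  · exact_mod_cast hsum₁ L hL
  · exact_mod_cast hsum₀ L hL

end Layers

section Coverings

/-- The width `166 / 1000` is just below `1 / 6`, as required for the cubes at the vertices, and
`129 / 1000` is just above `1 / 8`, where the boxes along the four-dimensional faces would have side
lengths `(1 - 2 / 8) / 3` adding up to `1`. -/
theorem skeletonCoverable_six : SkeletonCoverable (0 : Fin 6 → ℝ) 1 15292 := by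
  refine SkeletonCoverable.mono (IsLayering.skeletonCoverable_one
    (a := fun L _ => if L.card ≤ 2 then 166 / 1000 else if L.card = 3 then 129 / 1000 else 0)
    (m := fun L i => if L.card ≤ 2 then 4 else
      if L.card = 3 ∧ ∀ j ∈ L, j ≤ i then 4 else 3) ⟨?_, ?_, ?_, ?_⟩ ?_) ?_
  all_goals decide +kernel

/-- The width `199 / 1000` is just below `1 / 5`, as required for the cubes at the vertices, and
`132 / 1000` is just below the value for which the side lengths of the boxes along the
two-dimensional faces add up to `1`. -/
theorem skeletonCoverable_five : SkeletonCoverable (0 : Fin 5 → ℝ) 1 1072 := by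
  refine SkeletonCoverable.mono (IsLayering.skeletonCoverable_one
    (a := fun L _ => if L.card ≤ 1 then 199 / 1000 else if L.card = 2 then 132 / 1000 else 0)
    (m := fun L i => if L.card = 1 then 3 else
      if L.card = 3 ∧ ∀ j ∈ L, j ≤ i then 3 else 2) ⟨?_, ?_, ?_, ?_⟩ ?_) ?_
  all_goals decide +kernel

/-- The tournament `0 → 1`, `0 → 2`, `1 → 2`, `1 → 3`, `2 → 3`, `3 → 0` decides how the
two-dimensional faces are cut: a face with directions `i → j` is halved in the direction `i`, and
the boxes along the edges with direction `i` are wider in the direction `j` to shorten it there. -/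
theorem skeletonCoverable_four : SkeletonCoverable (0 : Fin 4 → ℝ) 1 96 := by
  refine SkeletonCoverable.mono (IsLayering.skeletonCoverable_one
    (a := fun L j => if L.card = 0 then (if j < 2 then 27 / 100 else 22 / 100) else
      if L.card = 1 then
        ∑ i ∈ L, if j = i + 1 ∨ j = i + 2 ∧ i < 2 then 21 / 100 else 1 / 10
      else 0)
    (m := fun L i => if ∃ j ∈ L, j = i + 1 ∨ j = i + 2 ∧ i < 2 then 2 else 1)
    ⟨?_, ?_, ?_, ?_⟩ ?_) ?_
  all_goals decide +kernel

/-- The widths of the boxes of a layering of the four-dimensional unit cube, all of whose boxes have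
side lengths that add up to exactly `1`. -/
def tightWidth (L : Finset (Fin 4)) (j : Fin 4) : ℚ :=
  if L.card = 0 then 1 / 4 else if L.card = 1 ∧ j - 1 ∉ L then 1 / 4 else 0

/-- The widths of the boxes of a layering of the four-dimensional unit cube after it is flattened in
the direction `k`. -/
def flatWidth (k : Fin 4) (L : Finset (Fin 4)) (j : Fin 4) : ℚ :=
  if j = k then 0
  else if L.card = 0 then 5 / 16
  else if L.card = 1 ∧ j - 1 ∉ L then
    if (j = k + 3 ∧ k + 1 ∈ L) ∨ k ∈ L then 1 / 4 else 3 / 10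
  else 0

theorem skeletonCoverable_four_update (k : Fin 4) {ℓ : ℝ} (hℓ : ℓ ∈ Ico 0 1) :
    SkeletonCoverable 0 (Function.update 1 k ℓ) 88 := by
  refine SkeletonCoverable.mono (IsLayering.skeletonCoverable_update
    (a₀ := flatWidth k) (a₁ := tightWidth) (m := fun L i => if i - 1 ∈ L then 2 else 1)
    ⟨?_, ?_, ?_, ?_⟩ ⟨?_, ?_, ?_, ?_⟩ ?_ ?_ hℓ) ?_
  all_goals
    revert k
    decide +kernel

end Coverings

section CoveringNumber

theorem hadwigerCoveringNumber_le_of_skeletonCoverable {n : ℕ} [Nontrivial (Fin n)] {N : ℕ∞}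
    (h : SkeletonCoverable (0 : Fin n → ℝ) 1 N) : hadwigerCoveringNumber n ≤ N + n * 2 :=
  hadwigerCoveringNumber_le_of_forall_illuminates fun K hK => by
    simpa using hK.exists_illuminates h

theorem hadwigerCoveringNumber_le_max_of_skeletonCoverable {n : ℕ} [Nontrivial (Fin n)] {M N : ℕ∞}
    (h : SkeletonCoverable (0 : Fin n → ℝ) 1 M)
    (hupdate : ∀ k, ∀ ℓ ∈ Ioo (0 : ℝ) 1,
      SkeletonCoverable (0 : Fin n → ℝ) (Function.update 1 k ℓ) N) :
    hadwigerCoveringNumber n ≤ max M (N + n * 2) := by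
  refine hadwigerCoveringNumber_le_of_forall_illuminates fun K hK => ?_
  by_cases hF : ∃ f, (K ∩ boxFacet 0 1 f).Subsingleton
  · obtain ⟨f, hf⟩ := hF
    obtain ⟨U, hUN, hU⟩ := hK.exists_illuminates_of_subsingleton hf (hupdate f.1)
    exact ⟨U, le_max_of_le_right (by simpa using hUN), hU⟩
  · simp only [not_exists, not_subsingleton_iff] at hF
    obtain ⟨U, hUM, hU⟩ := hK.exists_illuminates_of_nontrivial h hF
    exact ⟨U, le_max_of_le_left hUM, hU⟩

theorem hadwigerCoveringNumber_four_le : hadwigerCoveringNumber 4 ≤ 96 :=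
  (hadwigerCoveringNumber_le_max_of_skeletonCoverable skeletonCoverable_four fun k _ hℓ =>
    skeletonCoverable_four_update k (Ioo_subset_Ico_self hℓ)).trans (by norm_num)

theorem hadwigerCoveringNumber_five_le : hadwigerCoveringNumber 5 ≤ 1082 :=
  (hadwigerCoveringNumber_le_of_skeletonCoverable skeletonCoverable_five).trans (by norm_num)

theorem hadwigerCoveringNumber_six_le : hadwigerCoveringNumber 6 ≤ 15304 :=
  (hadwigerCoveringNumber_le_of_skeletonCoverable skeletonCoverable_six).trans (by norm_num)

end CoveringNumber

theorem mainTheorem1 :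
    hadwigerCoveringNumber 4 ≤ 96 ∧ hadwigerCoveringNumber 5 ≤ 1091 ∧
      hadwigerCoveringNumber 6 ≤ 15373 :=
  ⟨hadwigerCoveringNumber_four_le, hadwigerCoveringNumber_five_le.trans (by norm_num),
    hadwigerCoveringNumber_six_le.trans (by norm_num)⟩
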